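/- A Dyck path of size $n$ is a word with $n$ letters $U$ and $n$ letters $D$ each of whose prefixes contains at least as many $U$'s as $D$'s. Let $D_n$ be the set of Dyck paths of size $n$ with the ascent order, i.e. the reflexive-transitive closure of the relation "$Q$ is obtained from $P$ by replacing a factor $DU^kD$ ($k\ge 1$) by $U^kDD$". A graph is a set of vertices with a reflexive symmetric edge relation; the Hasse graph of a poset has as edges the loops and the pairs $\{a,b\}$ where one of $a,b$ covers the other. In a topological graph (compact, Hausdorff, zero-dimensional, second countable vertex space; closed edge relation), a set $S$ of vertices is connected if it is not a union of two nonempty relatively closed subsets with no edge between them. An epimorphism of graphs is a (continuous) map that sends edges to edges and is surjective on vertices and on edges; it is monotone if preimages of closed connected sets are connected. A topological graph is Kelley if it is connected and for every nonempty closed connected set $K$ of vertices, every $p\in K$ and every sequence of vertices $p_m\to p$ there are closed connected sets $K_m\ni p_m$ with $K_m\to K$ in the Hausdorff metric. For $n\ge1$ let $f_n:D_n\to D_{n-1}$ delete the first peak (factor $UD$) of a Dyck path. Let $D=\varprojlim(D_n,f_n)_{n\ge1}\subseteq\prod_{n\ge1}D_n$, with the topology induced by the product of the discrete spaces $D_n$,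 with $\langle x,y\rangle$ an edge iff $\langle x_n,y_n\rangle$ is an edge of the Hasse graph of $D_n$ for every $n$, and with the order $x\le y$ iff $x_n\le y_n$ for every $n$. Then: 1. Each $D_n$ is a lattice, and it is non-distributive for $n\ge3$. 2. Each $f_n$ ($n\ge1$) is an epimorphism of posets, i.e. it is order preserving, surjective, and every pair $Q\le Q'$ in $D_{n-1}$ is the image of a pair $P\le P'$ in $D_n$. 3. For each $n\ge1$, the fibre of $f_n$ over every vertex is connected in the Hasse graph of $D_n$, and $f_n$ is a monotone epimorphism from the Hasse graph of $D_n$ onto that of $D_{n-1}$. 4. The topological graph $D$ is Kelley. 5. The poset $D$ is a lattice and is not distributive. -/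

import Mathlib

/-! ### Dyck paths and the ascent order -/

/-- `D_n`: the Dyck paths of size `n` (with `n` up steps). No order is inherited from `DyckWord`. -/
def DyckPath (n : ℕ) : Type := {p : DyckWord // p.semilength = n}

namespace DyckPath

open DyckStep

/-- The word of up and down steps of a Dyck path. -/
def steps {n : ℕ} (P : DyckPath n) : List DyckStep := P.1.toList

theorem steps_injective {n : ℕ} : Function.Injective (steps (n := n)) :=
  fun _ _ h => Subtype.ext (DyckWord.ext h)

/-- `Q` is obtained from `P` by replacing a factor `D U^k D` (with `k ≥ 1`) by `U^k D D`. -/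
def AscentStep {n : ℕ} (P Q : DyckPath n) : Prop :=
  ∃ (k : ℕ) (a b : List DyckStep), 1 ≤ k ∧
    P.steps = a ++ [D] ++ List.replicate k U ++ [D] ++ b ∧
    Q.steps = a ++ List.replicate k U ++ [D, D] ++ b

/-- The number of pairs consisting of a `U` and a later `D`; it increases along ascent steps
and serves to prove antisymmetry. -/
def weight : List DyckStep → ℕ
  | [] => 0
  | U :: l => l.count D + weight l
  | D :: l => weight l

theorem weight_append_lt (a : List DyckStep) {x y : List DyckStep}
    (hc : x.count D = y.count D) (h : weight x < weight y) :
    weight (a ++ x) < weight (a ++ y) := by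
  induction a with
  | nil => simpa using h
  | cons s a ih =>
    cases s
    · simp only [List.cons_append, weight, List.count_append, hc]; omega
    · simpa only [List.cons_append, weight] using ih

theorem weight_replicate (k : ℕ) (m : List DyckStep) :
    weight (List.replicate k U ++ m) = k * m.count D + weight m := by
  induction k with
  | zero => simp
  | succ k ih =>
    have h : (List.replicate k U).count D = 0 := by
      rw [List.count_eq_zero]; intro h; simp [List.mem_replicate] at h
    simp only [List.replicate_succ, List.cons_append, weight, ih, List.count_append, h]
    ring

theorem AscentStep.weight_lt {n : ℕ} {P Q : DyckPath n} (h : AscentStep P Q) :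
    weight P.steps < weight Q.steps := by
  obtain ⟨k, a, b, hk, hP, hQ⟩ := h
  rw [hP, hQ]
  simp only [List.append_assoc]
  apply weight_append_lt
  · simp [List.count_append]; omega
  · simp only [List.cons_append, List.nil_append, weight, weight_replicate, List.count_cons_self]
    nlinarith

/-- The ascent order on `D_n`: the reflexive-transitive closure of the ascent steps. -/
instance (n : ℕ) : PartialOrder (DyckPath n) where
  le := Relation.ReflTransGen AscentStep
  le_refl _ := Relation.ReflTransGen.refl
  le_trans _ _ _ := Relation.ReflTransGen.trans
  le_antisymm P Q h₁ h₂ := by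
    have key : ∀ {R S : DyckPath n}, Relation.ReflTransGen AscentStep R S →
        weight R.steps ≤ weight S.steps := by
      intro R S h
      induction h with
      | refl => exact le_rfl
      | tail _ h ih => exact ih.trans h.weight_lt.le
    rcases Relation.ReflTransGen.cases_head h₁ with h | ⟨R, hR, hRQ⟩
    · exact h
    · exact absurd (hR.weight_lt.trans_le ((key hRQ).trans (key h₂))) (lt_irrefl _)

/-- The finite set `D_n` is a discrete space. -/
instance (n : ℕ) : TopologicalSpace (DyckPath n) := ⊥

instance (n : ℕ) : DiscreteTopology (DyckPath n) := ⟨rfl⟩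

/-- Delete the first factor `UD` of a word. -/
def deleteFirstPeak : List DyckStep → List DyckStep
  | U :: D :: l => l
  | s :: l => s :: deleteFirstPeak l
  | [] => []

theorem exists_peak : ∀ m : List DyckStep, D ∈ m →
    ∃ a b, U :: m = a ++ U :: D :: b ∧ deleteFirstPeak (U :: m) = a ++ b
  | [], h => by simp at h
  | D :: m, _ => ⟨[], m, rfl, rfl⟩
  | U :: m, h => by
    obtain ⟨a, b, h₁, h₂⟩ := exists_peak m (by simpa using h)
    exact ⟨U :: a, b, by simp [h₁], by simp [deleteFirstPeak, h₂]⟩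

theorem exists_peak_steps {n : ℕ} (P : DyckPath (n + 1)) :
    ∃ a b, P.steps = a ++ U :: D :: b ∧ deleteFirstPeak P.steps = a ++ b := by
  have hU : P.steps.count U = n + 1 := P.2
  have hD : P.steps.count D = n + 1 := P.1.count_U_eq_count_D.symm.trans hU
  have h1 := P.1.count_D_le_count_U 1
  change (P.steps.take 1).count D ≤ (P.steps.take 1).count U at h1
  generalize P.steps = l at *
  match l with
  | [] => simp at hU
  | D :: m => simp at h1
  | U :: m =>
    apply exists_peak
    rw [← List.count_pos_iff]
    simp at hD
    omega

/-- The map `f : D_{n+1} → D_n` that deletes the first peak `UD` of a Dyck path. -/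
def delPeak (n : ℕ) (P : DyckPath (n + 1)) : DyckPath n :=
  ⟨{ toList := deleteFirstPeak P.steps
     count_U_eq_count_D := by
      obtain ⟨a, b, h₁, h₂⟩ := exists_peak_steps P
      have h : P.steps.count U = P.steps.count D := P.1.count_U_eq_count_D
      rw [h₁] at h
      rw [h₂]
      simp [List.count_append] at h ⊢
      omega
     count_D_le_count_U := by
      intro i
      obtain ⟨a, b, h₁, h₂⟩ := exists_peak_steps P
      have h : ∀ j, (P.steps.take j).count D ≤ (P.steps.take j).count U :=
        P.1.count_D_le_count_U
      rw [h₁] at h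
      rw [h₂]
      rcases le_total i a.length with hi | hi
      · have := h i
        rwa [List.take_append_of_le_length hi] at this ⊢
      · obtain ⟨j, rfl⟩ := Nat.exists_eq_add_of_le hi
        have := h (a.length + (j + 2))
        rw [List.take_length_add_append] at this ⊢
        simp [List.count_append] at this ⊢
        omega },
    by
      obtain ⟨a, b, h₁, h₂⟩ := exists_peak_steps P
      have h : P.steps.count U = n + 1 := P.2
      rw [h₁] at h
      change (deleteFirstPeak P.steps).count U = n
      rw [h₂]
      simp [List.count_append] at h ⊢
      omega⟩

end DyckPath

/-! ### Topological graphs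

A graph on the vertex set `X` is given by its edge relation `E : X → X → Prop`. -/

/-- A topological graph: the vertex space is compact, Hausdorff, zero-dimensional and second
countable, and the edge relation is reflexive, symmetric and closed. -/
structure IsTopologicalGraph {X : Type*} [TopologicalSpace X] (E : X → X → Prop) : Prop where
  compact : CompactSpace X
  hausdorff : T2Space X
  zeroDim : TopologicalSpace.IsTopologicalBasis {s : Set X | IsClopen s}
  secondCountable : SecondCountableTopology X
  refl : ∀ x, E x x
  symm : ∀ x y, E x y → E y x
  closed : IsClosed {p : X × X | E p.1 p.2}

/-- A set `S` of vertices is connected if it is not the union of two nonempty relatively closed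
subsets with no edge between them. -/
def GraphConnected {X : Type*} [TopologicalSpace X] (E : X → X → Prop) (S : Set X) : Prop :=
  ∀ F G : Set X, IsClosed F → IsClosed G → S ⊆ F ∪ G → (S ∩ F).Nonempty → (S ∩ G).Nonempty →
    ∃ a ∈ S ∩ F, ∃ b ∈ S ∩ G, E a b

/-- `f` preserves the relations and is surjective on elements and on related pairs. -/
structure IsRelEpi {X Y : Type*} (r : X → X → Prop) (s : Y → Y → Prop) (f : X → Y) : Prop where
  map_rel : ∀ a b, r a b → s (f a) (f b)
  surjective : Function.Surjective f
  rel_surjective : ∀ c d, s c d → ∃ a b, r a b ∧ f a = c ∧ f b = d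

/-- A (continuous) epimorphism of topological graphs is monotone if preimages of closed connected
sets are connected. -/
structure IsMonotoneGraphEpi {X Y : Type*} [TopologicalSpace X] [TopologicalSpace Y]
    (E : X → X → Prop) (E' : Y → Y → Prop) (f : X → Y) : Prop where
  continuous : Continuous f
  epi : IsRelEpi E E' f
  preimage_connected : ∀ S : Set Y, IsClosed S → GraphConnected E' S → GraphConnected E (f ⁻¹' S)

/-- A topological graph is Kelley if it is connected and, for every nonempty closed (equivalently,
compact) connected set `K` of vertices, every `p ∈ K` and every sequence `u` of vertices with
`u n → p`, there are closed connected sets `L n` with `u n ∈ L n` and `L n → K` in the hyperspace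
of nonempty compact sets (with the topology of the Hausdorff metric). -/
structure IsKelley {X : Type*} [TopologicalSpace X] (E : X → X → Prop) : Prop where
  isTopologicalGraph : IsTopologicalGraph E
  connected : GraphConnected E Set.univ
  kelley : ∀ K : TopologicalSpace.NonemptyCompacts X, GraphConnected E (K : Set X) →
    ∀ p ∈ K, ∀ u : ℕ → X, Filter.Tendsto u Filter.atTop (nhds p) →
      ∃ L : ℕ → TopologicalSpace.NonemptyCompacts X,
        (∀ n, GraphConnected E (L n : Set X)) ∧ (∀ n, u n ∈ L n) ∧
          Filter.Tendsto L Filter.atTop (nhds K)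

/-- The Hasse graph of a poset, with a loop at every vertex. -/
def HasseEdge {α : Type*} [PartialOrder α] (a b : α) : Prop :=
  a = b ∨ (SimpleGraph.hasse α).Adj a b

/-! ### The inverse limit -/

/-- The inverse limit of an inverse sequence, as a subspace (and subposet) of the product. -/
abbrev InverseLimit (F : ℕ → Type) (α : ∀ n, F (n + 1) → F n) : Type :=
  {x : ∀ n, F n // ∀ n, α n (x (n + 1)) = x n}

/-- The inverse limit `D` of `D_1 ← D_2 ← D_3 ← ⋯`; the coordinate with index `n` lies in
`D_{n+1}`. Its topology and its order are those induced from the product. -/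
abbrev AscentLimit : Type :=
  InverseLimit (fun n => DyckPath (n + 1)) (fun n => DyckPath.delPeak (n + 1))

/-- The edges of the inverse limit of the Hasse graphs: edges in every coordinate. -/
def LimitEdge (x y : AscentLimit) : Prop := ∀ n, HasseEdge (x.1 n) (y.1 n)

/-! ### Lattices -/

/-- The partially ordered set `α` is a lattice. -/
def IsLatticeOrder (α : Type*) [inst : PartialOrder α] : Prop :=
  ∃ L : Lattice α, L.toPartialOrder = inst

/-- The partially ordered set `α` is a lattice in which a distributive law fails. -/
def IsNonDistributiveLattice (α : Type*) [inst : PartialOrder α] : Prop :=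
  ∃ L : Lattice α, L.toPartialOrder = inst ∧
    ∃ x y z : α, L.inf x (L.sup y z) ≠ L.sup (L.inf x y) (L.inf x z)

/-! A Dyck path is encoded by the sequence whose `j`-th term is the number of `U`s behind the `j`-th
`D`, counted from the end of the word and from `0`. These sequences are weakly increasing and
bounded by the identity. Continued constantly, those of size `n` are the fixed points of `trunc n`
in `AscentSeq`.

Counting from the end makes everything independent of `n`. Deleting the first peak forgets the term
at position `n` (`delPeak_eq_ofSeq`), so the inverse limit is all of `AscentSeq`. An ascent step
lowers one term to its predecessor (`ascentStep_iff`). The order generated by these steps says that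
every term of the larger sequence occurs in the smaller one, no later (`le_iff`, by
`exists_lower_le`), and the steps are exactly its covers (`covBy_iff`).

In this order all suprema exist (`isLUB_supSeq`). Truncation makes each `D_n` an order retract of
the complete lattice `AscentSeq`, hence a lattice, and a pentagon on the first three positions
refutes distributivity both there and in the limit.

For the graphs, the fibre over `Q` is a star around the path that repeats the last term of `Q`, and
for finite graphs connected fibres make an epimorphism monotone. In a limit of monotone
epimorphisms, cylinders over connected sets are connected (`graphConnected_preimage`). The cylinders
over the projections of a connected `K` shrink to `K`, and the one at the deepest level where `u m`
agrees with `p` contains `u m`; this is the Kelley property. -/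

/-! ### Ascent sequences -/

/-- Weakly increasing sequences `e` of natural numbers with `e j ≤ j`. -/
def AscentSeq : Type := {e : ℕ → ℕ // Monotone e ∧ ∀ j, e j ≤ j}

namespace AscentSeq

instance : CoeFun AscentSeq (fun _ => ℕ → ℕ) := ⟨Subtype.val⟩

theorem mono (x : AscentSeq) {i j : ℕ} (h : i ≤ j) : x i ≤ x j := x.2.1 h

theorem le_self (x : AscentSeq) (j : ℕ) : x j ≤ j := x.2.2 j

theorem zero (x : AscentSeq) : x 0 = 0 := Nat.le_zero.1 (x.le_self 0)

theorem ext {x y : AscentSeq} (h : ∀ j, x j = y j) : x = y := Subtype.ext (funext h)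

/-- `x ≤ y` if every term of `y` occurs in `x`, at the same position or before. -/
instance : PartialOrder AscentSeq where
  le x y := ∀ j, ∃ i ≤ j, y j = x i
  le_refl x j := ⟨j, le_rfl, rfl⟩
  le_trans x y z hxy hyz k := by
    obtain ⟨j, hj, h⟩ := hyz k
    obtain ⟨i, hi, h'⟩ := hxy j
    exact ⟨i, hi.trans hj, h.trans h'⟩
  le_antisymm x y hxy hyx := by
    refine ext fun j => le_antisymm ?_ ?_
    · obtain ⟨i, hi, h⟩ := hyx j
      exact h.trans_le (y.mono hi)
    · obtain ⟨i, hi, h⟩ := hxy j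
      exact h.trans_le (x.mono hi)

theorem apply_le_of_le {x y : AscentSeq} (h : x ≤ y) (j : ℕ) : y j ≤ x j := by
  obtain ⟨i, hi, h⟩ := h j
  exact h.trans_le (x.mono hi)

open Classical in
/-- The `j`-th term of the supremum of `S` is the largest value that all elements of `S` attain
up to position `j`. -/
noncomputable def supSeq (S : Set AscentSeq) : AscentSeq :=
  -- The search bound `j` ensures `e j ≤ j`; for empty `S` it yields the identity sequence, which is
  -- the least element.
  ⟨fun j => Nat.findGreatest (fun v => ∀ x ∈ S, ∃ i ≤ j, x i = v) j, by
    intro j k hjk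
    refine Nat.findGreatest_mono (fun v hv x hx => ?_) hjk
    obtain ⟨i, hi, h⟩ := hv x hx
    exact ⟨i, hi.trans hjk, h⟩, fun j => Nat.findGreatest_le j⟩

theorem exists_eq_supSeq {S : Set AscentSeq} {x : AscentSeq} (hx : x ∈ S) (j : ℕ) :
    ∃ i ≤ j, x i = supSeq S j := by
  classical
  exact Nat.findGreatest_spec (P := fun v => ∀ x ∈ S, ∃ i ≤ j, x i = v) (Nat.zero_le j)
    (fun x _ => ⟨0, Nat.zero_le _, x.zero⟩) x hx

theorem le_supSeq {S : Set AscentSeq} {j v : ℕ} (hv : v ≤ j)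
    (h : ∀ x ∈ S, ∃ i ≤ j, x i = v) : v ≤ supSeq S j := by
  classical
  exact Nat.le_findGreatest (P := fun v => ∀ x ∈ S, ∃ i ≤ j, x i = v) hv h

/-- For leastness, let `v = u j` and let `m` be the first position with `v ≤ m` by which all of `S`
has attained `v`. Then the supremum equals `v` at `m`: by minimality either `v = m`, the largest
value allowed there, or some `x ∈ S` attains `v` only from `m` on, so its values up to `m` are at
most `v`. -/
theorem isLUB_supSeq (S : Set AscentSeq) : IsLUB S (supSeq S) := by
  constructor
  · intro x hx j
    obtain ⟨i, hi, h⟩ := exists_eq_supSeq hx j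
    exact ⟨i, hi, h.symm⟩
  · intro u hu j
    have hex : ∃ m, u j ≤ m ∧ ∀ x ∈ S, ∃ i ≤ m, x i = u j := by
      refine ⟨j, u.le_self j, fun x hx => ?_⟩
      obtain ⟨i, hi, h⟩ := hu hx j
      exact ⟨i, hi, h.symm⟩
    classical
    obtain ⟨hm, hS⟩ := Nat.find_spec hex
    have hmin := fun m (h : m < Nat.find hex) => Nat.find_min hex h
    have hj : Nat.find hex ≤ j := by
      refine Nat.find_min' hex ⟨u.le_self j, fun x hx => ?_⟩
      obtain ⟨i, hi, h⟩ := hu hx j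
      exact ⟨i, hi, h.symm⟩
    generalize Nat.find hex = m at *
    refine ⟨m, hj, le_antisymm (le_supSeq hm hS) ?_⟩
    rcases m with _ | m
    · rw [zero]
      exact Nat.zero_le _
    · have h := hmin m (Nat.lt_succ_self m)
      by_cases h' : u j ≤ m
      · simp only [h', true_and, not_forall, not_exists, not_and] at h
        obtain ⟨x, hx, hne⟩ := h
        obtain ⟨i, hi, hxi⟩ := hS x hx
        obtain rfl : i = m + 1 := by
          by_contra hne'
          exact hne i (by omega) hxi
        obtain ⟨l, hl, hxl⟩ := exists_eq_supSeq hx (m + 1)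
        rw [← hxl, ← hxi]
        exact x.mono hl
      · exact ((supSeq S).le_self _).trans (by omega)

noncomputable instance : SupSet AscentSeq := ⟨supSeq⟩

noncomputable instance : CompleteLattice AscentSeq :=
  completeLatticeOfSup AscentSeq isLUB_supSeq

/-- Truncation: the sequence is made constant from position `n - 1` on. -/
def trunc (n : ℕ) (x : AscentSeq) : AscentSeq :=
  ⟨fun j => x (min j (n - 1)), fun _ _ h => x.mono (min_le_min_right _ h),
    fun _ => (x.le_self _).trans (min_le_left _ _)⟩

theorem trunc_apply (n : ℕ) (x : AscentSeq) (j : ℕ) : trunc n x j = x (min j (n - 1)) := rfl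

theorem trunc_apply_of_lt {n : ℕ} (x : AscentSeq) {j : ℕ} (h : j < n) : trunc n x j = x j := by
  rw [trunc_apply, min_eq_left (by omega)]

theorem trunc_mono (n : ℕ) : Monotone (trunc n) := by
  intro x y h j
  obtain ⟨i, hi, h⟩ := h (min j (n - 1))
  refine ⟨i, hi.trans (min_le_left _ _), ?_⟩
  rw [trunc_apply, trunc_apply, h, min_eq_left (hi.trans (min_le_right _ _))]

theorem trunc_eq_iff {n : ℕ} {x y : AscentSeq} :
    trunc n x = trunc n y ↔ ∀ j < n, x j = y j := by
  constructor
  · intro h j hj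
    rw [← trunc_apply_of_lt x hj, h, trunc_apply_of_lt y hj]
  · intro h
    refine ext fun j => ?_
    rw [trunc_apply, trunc_apply]
    rcases n with _ | n
    · simp [zero]
    · exact h _ (by omega)

theorem trunc_le_trunc_iff {n : ℕ} {x y : AscentSeq} :
    trunc n x ≤ trunc n y ↔ ∀ j < n, ∃ i ≤ j, y j = x i := by
  constructor
  · intro h j hj
    obtain ⟨i, hi, h⟩ := h j
    exact ⟨i, hi, by rwa [trunc_apply_of_lt _ hj, trunc_apply_of_lt _ (hi.trans_lt hj)] at h⟩
  · intro h j
    rcases n with _ | n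
    · exact ⟨0, Nat.zero_le _, by simp [trunc_apply, zero]⟩
    · obtain ⟨i, hi, h⟩ := h (min j n) (by omega)
      refine ⟨i, by omega, ?_⟩
      rw [trunc_apply_of_lt _ (by omega : i < n + 1), ← h]
      rfl

/-- Replace the term at position `j + 1` by its predecessor. -/
def lower (x : AscentSeq) (j : ℕ) : AscentSeq :=
  ⟨fun i => if i = j + 1 then x j else x i, by
    refine monotone_nat_of_le_succ fun i => ?_
    have h₁ := x.mono (Nat.le_succ i)
    have h₂ := x.mono (Nat.le_succ j)
    have h₃ := x.mono (Nat.le_succ (j + 1))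
    simp only [Nat.succ_eq_add_one] at *
    split_ifs with h h' h'
    · omega
    · subst h; omega
    · have : i = j := by omega
      subst this; omega
    · exact h₁, fun i => by
    have := x.le_self j
    have := x.le_self i
    dsimp only
    split_ifs <;> omega⟩

theorem lower_apply_self (x : AscentSeq) (j : ℕ) : x.lower j (j + 1) = x j := if_pos rfl

theorem lower_apply_of_ne (x : AscentSeq) {i j : ℕ} (h : i ≠ j + 1) : x.lower j i = x i :=
  if_neg h

/-- Below position `n`, the sequence `y` arises from `x` by lowering one term to its
predecessor. -/
def IsStep (n : ℕ) (x y : AscentSeq) : Prop :=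
  ∃ j, j + 1 < n ∧ x j < x (j + 1) ∧ ∀ i < n, y i = x.lower j i

theorem trunc_lower_le (n : ℕ) (x : AscentSeq) (j : ℕ) : trunc n x ≤ trunc n (x.lower j) := by
  refine trunc_mono n fun i => ?_
  by_cases h : i = j + 1
  · exact ⟨j, by omega, by rw [h, lower_apply_self]⟩
  · exact ⟨i, le_rfl, lower_apply_of_ne x h⟩

/-- If `x < y` below position `n`, then some term of `x` can be lowered without leaving the
lower bounds of `y`. -/
theorem exists_lower_le {n : ℕ} {x y : AscentSeq} (h : trunc n x ≤ trunc n y)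
    (hne : trunc n x ≠ trunc n y) :
    ∃ j, j + 1 < n ∧ x j < x (j + 1) ∧ trunc n (x.lower j) ≤ trunc n y := by
  classical
  rw [trunc_le_trunc_iff] at h
  have hle : ∀ j < n, y j ≤ x j := fun j hj => by
    obtain ⟨i, hi, h⟩ := h j hj
    exact h.trans_le (x.mono hi)
  -- Take the last position `j` where `x` and `y` differ. The term to be lowered is the first one in
  -- `x` with the value `x j`.
  obtain ⟨j, hj, hlt, hlast⟩ : ∃ j < n, y j < x j ∧ ∀ i < n, j < i → y i = x i := by
    have hex : ∃ j, j < n ∧ y j < x j := by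
      by_contra hcon
      push Not at hcon
      exact hne (trunc_eq_iff.2 fun j hj => le_antisymm (hcon j hj) (hle j hj))
    obtain ⟨j₀, hj₀, hlt₀⟩ := hex
    have hs := Nat.findGreatest_spec (P := fun j => j < n ∧ y j < x j) hj₀.le ⟨hj₀, hlt₀⟩
    refine ⟨_, hs.1, hs.2, fun i hi hji => ?_⟩
    have := Nat.findGreatest_is_greatest hji hi.le
    have := hle i hi
    simp only [not_and, not_lt] at *
    omega
  have hex : ∃ m, x m = x j := ⟨j, rfl⟩
  have hm := Nat.find_spec hex
  have hmin := fun m (h : m < Nat.find hex) => Nat.find_min hex h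
  have hmj : Nat.find hex ≤ j := Nat.find_min' hex rfl
  generalize Nat.find hex = m at *
  obtain ⟨m, rfl⟩ : ∃ l, m = l + 1 := by
    refine Nat.exists_eq_succ_of_ne_zero fun h0 => ?_
    rw [h0, zero] at hm
    omega
  refine ⟨m, by omega, ?_, ?_⟩
  · have h₁ := hmin m (Nat.lt_succ_self m)
    have h₂ := x.mono (Nat.le_succ m)
    simp only [Nat.succ_eq_add_one] at h₂
    omega
  · rw [trunc_le_trunc_iff]
    intro i hi
    obtain ⟨l, hl, hyl⟩ := h i hi
    by_cases hlm : l = m + 1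
    -- Only a term of `y` witnessed by the lowered position needs a new witness. If the value `x j`
    -- is repeated in `x`, the next position serves; otherwise the term lies behind `j`, where `x`
    -- and `y` agree.
    · subst hlm
      rcases Nat.lt_or_ge (m + 1) j with hmj' | hmj'
      · by_cases him : i = m + 1
        · subst him
          have := y.mono hmj
          omega
        · refine ⟨m + 2, by omega, ?_⟩
          rw [lower_apply_of_ne x (by omega), hyl]
          have h₁ := x.mono (show m + 1 ≤ m + 2 by omega)
          have h₂ := x.mono (show m + 2 ≤ j by omega)
          omega
      · obtain rfl : j = m + 1 := by omega
        have hij : m + 1 < i := by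
          rcases hl.lt_or_eq with h | h
          · exact h
          · subst h; omega
        exact ⟨i, le_rfl, by rw [lower_apply_of_ne x (by omega), hlast i hi hij]⟩
    · exact ⟨l, hl, by rw [lower_apply_of_ne x hlm, hyl]⟩

end AscentSeq

/-! ### Words of up and down steps -/

namespace DyckPath

open DyckStep

/-- The number of `U`s behind the `D` with index `j`, where the `D`s are counted from the end of
the word, starting with index `0`; for large `j`, the number of `U`s behind the first `D`. -/
def upsAfter : List DyckStep → ℕ → ℕ
  | [], _ => 0
  | U :: l, j => upsAfter l j
  | D :: l, j => if j < l.count D then upsAfter l j else l.count U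

theorem upsAfter_le_count (l : List DyckStep) (j : ℕ) : upsAfter l j ≤ l.count U := by
  induction l with
  | nil => simp [upsAfter]
  | cons s l ih =>
    cases s
    · simp only [upsAfter, List.count_cons_self]; omega
    · simp only [upsAfter]
      split_ifs <;> simp [ih]

theorem upsAfter_mono (l : List DyckStep) : Monotone (upsAfter l) := by
  induction l with
  | nil => intro i j _; simp [upsAfter]
  | cons s l ih =>
    cases s
    · exact ih
    · intro i j hij
      simp only [upsAfter]
      split_ifs
      · exact ih hij
      · exact upsAfter_le_count l i
      · omega
      · exact le_rfl

theorem upsAfter_of_count_le {l : List DyckStep} {j : ℕ} (h : l.count D ≤ j + 1) :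
    upsAfter l j = upsAfter l (l.count D - 1) := by
  induction l with
  | nil => simp [upsAfter]
  | cons s l ih =>
    cases s
    · simpa [upsAfter] using ih (by simpa using h)
    · simp at h
      simp [upsAfter, Nat.not_lt.2 h]

theorem upsAfter_append {a x : List DyckStep} {j : ℕ} (h : j < x.count D) :
    upsAfter (a ++ x) j = upsAfter x j := by
  induction a with
  | nil => rfl
  | cons s a ih =>
    cases s
    · exact ih
    · simp only [List.cons_append, upsAfter]
      rw [if_pos (by rw [List.count_append]; omega), ih]

/-- A `D` inside `a` has all of `x` behind it, so only the letter counts of `x` matter. -/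
theorem upsAfter_append_congr {a x y : List DyckStep} {j : ℕ} (hU : x.count U = y.count U)
    (hD : x.count D = y.count D) (hj : x.count D ≤ j) (h : j < (a ++ x).count D) :
    upsAfter (a ++ x) j = upsAfter (a ++ y) j := by
  induction a with
  | nil => simp only [List.nil_append] at h; omega
  | cons s a ih =>
    cases s
    · exact ih (by simpa using h)
    · simp only [List.cons_append, upsAfter, List.count_append, hU, hD]
      split_ifs with h'
      · exact ih (by rw [List.count_append]; omega)
      · rfl

theorem upsAfter_replicate_append (k : ℕ) (l : List DyckStep) (j : ℕ) :
    upsAfter (List.replicate k U ++ l) j = upsAfter l j := by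
  induction k with
  | zero => rfl
  | succ k ih => simpa only [List.replicate_succ, List.cons_append, upsAfter] using ih

theorem count_D_replicate (k : ℕ) : (List.replicate k U).count D = 0 := by
  simp [List.count_replicate]

theorem count_D_replicate_append (k : ℕ) (l : List DyckStep) :
    (List.replicate k U ++ l).count D = l.count D := by
  simp [List.count_append, List.count_replicate]

theorem count_U_replicate_append (k : ℕ) (l : List DyckStep) :
    (List.replicate k U ++ l).count U = k + l.count U := by
  simp [List.count_append]

theorem eq_replicate_append_of_mem {l : List DyckStep} (h : D ∈ l) :
    ∃ k b, l = List.replicate k U ++ D :: b := by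
  induction l with
  | nil => simp at h
  | cons s l ih =>
    cases s
    · obtain ⟨k, b, rfl⟩ := ih (by simpa using h)
      exact ⟨k + 1, b, rfl⟩
    · exact ⟨0, l, rfl⟩

/-- The first letter is determined: a leading `D` has all `U`s of the word behind it, whereas after
a leading `U` no `D` does. -/
theorem eq_of_upsAfter_eq : ∀ {l m : List DyckStep}, l.count U = m.count U →
    l.count D = m.count D → (∀ j < l.count D, upsAfter l j = upsAfter m j) → l = m
  | [], [], _, _, _ => rfl
  | [], U :: m, hU, _, _ => by simp at hU
  | [], D :: m, _, hD, _ => by simp at hD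
  | U :: l, [], hU, _, _ => by simp at hU
  | D :: l, [], _, hD, _ => by simp at hD
  | U :: l, U :: m, hU, hD, h => by
    rw [eq_of_upsAfter_eq (l := l) (m := m) (by simpa using hU) (by simpa using hD)
      (by simpa [upsAfter] using h)]
  | D :: l, D :: m, hU, hD, h => by
    simp only [List.count_cons_self, Nat.add_right_cancel_iff] at hD
    rw [eq_of_upsAfter_eq (l := l) (m := m) (by simpa using hU) hD fun j hj => ?_]
    have := h j (by simp; omega)
    simpa only [upsAfter, hj, hD ▸ hj, if_true] using this
  | U :: l, D :: m, hU, hD, h => by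
    have hj := h (m.count D) (by rw [hD]; simp)
    have := upsAfter_le_count l (m.count D)
    simp [upsAfter] at hU hj
    omega
  | D :: l, U :: m, hU, hD, h => by
    have hj := h (l.count D) (by simp)
    have := upsAfter_le_count m (l.count D)
    simp [upsAfter] at hU hj
    omega

/-- The suffix behind the `D` with index `j` has exactly `j` letters `D`, so the ballot condition on
suffixes bounds its `U`s. -/
theorem upsAfter_le {l : List DyckStep} (h : ∀ s, s <:+ l → s.count U ≤ s.count D) (j : ℕ) :
    upsAfter l j ≤ j := by
  induction l with
  | nil => simp [upsAfter]
  | cons s l ih =>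
    have ih := ih fun s hs => h s (hs.trans (List.suffix_cons _ _))
    have := h l (List.suffix_cons _ _)
    cases s
    · exact ih
    · simp only [upsAfter]
      split_ifs <;> omega

/-- A place where `upsAfter` increases gives a factor `D U^k D`. -/
theorem exists_factor {l : List DyckStep} {j : ℕ} (hj : j + 1 < l.count D)
    (h : upsAfter l j < upsAfter l (j + 1)) :
    ∃ (k : ℕ) (a b : List DyckStep), 1 ≤ k ∧ b.count D = j ∧
      l = a ++ (D :: (List.replicate k U ++ D :: b)) := by
  induction l with
  | nil => simp at hj
  | cons s l ih =>
    cases s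
    · obtain ⟨k, a, b, hk, hb, rfl⟩ := ih (by simpa using hj) h
      exact ⟨k, U :: a, b, hk, hb, rfl⟩
    · simp only [List.count_cons_self] at hj
      by_cases hj' : j + 1 < l.count D
      · obtain ⟨k, a, b, hk, hb, rfl⟩ := ih hj' (by
          simpa only [upsAfter, hj', (Nat.lt_succ_self j).trans hj', if_true] using h)
        exact ⟨k, D :: a, b, hk, hb, rfl⟩
      -- Here the leading letter is itself the `D` with index `j + 1`, and the next `D` closes the
      -- factor.
      · have hmem : D ∈ l := List.count_pos_iff.1 (by omega)
        obtain ⟨k, b, rfl⟩ := eq_replicate_append_of_mem hmem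
        rw [count_D_replicate_append, List.count_cons_self] at hj hj'
        have hb : b.count D = j := by omega
        refine ⟨k, [], b, ?_, hb, rfl⟩
        simp [upsAfter, upsAfter_replicate_append, hb, count_D_replicate] at h
        omega

/-- The effect of an ascent step on `upsAfter`. -/
theorem upsAfter_ascent {k : ℕ} {a b : List DyckStep} {i : ℕ}
    (hi : i < (a ++ (D :: (List.replicate k U ++ D :: b))).count D) :
    upsAfter (a ++ (List.replicate k U ++ D :: D :: b)) i =
      if i = b.count D + 1 then upsAfter (a ++ (D :: (List.replicate k U ++ D :: b))) (b.count D)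
      else upsAfter (a ++ (D :: (List.replicate k U ++ D :: b))) i := by
  have hD : (D :: (List.replicate k U ++ D :: b)).count D = b.count D + 2 := by
    simp [count_D_replicate]
  have hD' : (List.replicate k U ++ D :: D :: b).count D = b.count D + 2 := by
    simp [count_D_replicate]
  have hU : (D :: (List.replicate k U ++ D :: b)).count U =
      (List.replicate k U ++ D :: D :: b).count U := by
    simp
  -- Smaller indices belong to the factor or to `b`, where the values can be computed; larger ones
  -- belong to `a`, which sees only letter counts.
  by_cases h : i < b.count D + 2
  · have h₁ := upsAfter_append (a := a) (hD'.symm ▸ h)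
    have h₂ := upsAfter_append (a := a) (x := D :: (List.replicate k U ++ D :: b)) (j := i)
      (by omega)
    have h₃ := upsAfter_append (a := a) (x := D :: (List.replicate k U ++ D :: b))
      (j := b.count D) (by omega)
    rw [h₁, h₂, h₃, upsAfter_replicate_append]
    simp only [upsAfter, upsAfter_replicate_append, count_D_replicate_append,
      List.count_cons_self, List.count_cons_of_ne (show D ≠ U by decide)]
    split_ifs <;> first | rfl | omega
  · rw [if_neg (by omega)]
    exact (upsAfter_append_congr hU (hD.trans hD'.symm) (by omega) hi).symm

theorem upsAfter_ascent_lt (k : ℕ) (hk : 1 ≤ k) (a b : List DyckStep) :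
    upsAfter (a ++ (D :: (List.replicate k U ++ D :: b))) (b.count D) <
      upsAfter (a ++ (D :: (List.replicate k U ++ D :: b))) (b.count D + 1) := by
  have hD : (D :: (List.replicate k U ++ D :: b)).count D = b.count D + 2 := by
    simp [count_D_replicate]
  rw [upsAfter_append (by omega), upsAfter_append (by omega)]
  simp [upsAfter, upsAfter_replicate_append, count_D_replicate]
  omega

/-! ### Dyck paths and ascent sequences -/

theorem count_U_steps {n : ℕ} (P : DyckPath n) : P.steps.count U = n := P.2

theorem count_D_steps {n : ℕ} (P : DyckPath n) : P.steps.count D = n :=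
  P.1.count_U_eq_count_D.symm.trans P.2

theorem count_le_of_suffix {n : ℕ} (P : DyckPath n) {s : List DyckStep} (h : s <:+ P.steps) :
    s.count U ≤ s.count D := by
  obtain ⟨t, ht⟩ := h
  have h₁ := P.1.count_D_le_count_U t.length
  have h₂ := P.1.count_U_eq_count_D
  change (P.steps.take _).count D ≤ (P.steps.take _).count U at h₁
  change P.steps.count U = P.steps.count D at h₂
  rw [← ht] at h₁ h₂
  simp [List.count_append] at h₁ h₂
  omega

/-- The ascent sequence of a Dyck path. -/
def toSeq {n : ℕ} (P : DyckPath n) : AscentSeq :=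
  ⟨upsAfter P.steps, upsAfter_mono _, upsAfter_le fun _ => P.count_le_of_suffix⟩

theorem toSeq_apply {n : ℕ} (P : DyckPath n) (j : ℕ) : P.toSeq j = upsAfter P.steps j := rfl

theorem trunc_toSeq {n : ℕ} (P : DyckPath n) : AscentSeq.trunc n P.toSeq = P.toSeq := by
  refine AscentSeq.ext fun j => ?_
  rw [AscentSeq.trunc_apply]
  rcases le_total j (n - 1) with h | h
  · rw [min_eq_left h]
  · have hD := P.count_D_steps
    have := upsAfter_of_count_le (l := P.steps) (j := j) (by omega)
    rw [min_eq_right h, toSeq_apply, toSeq_apply, this, hD]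

theorem toSeq_injective {n : ℕ} : Function.Injective (toSeq (n := n)) := by
  intro P Q h
  refine steps_injective (eq_of_upsAfter_eq ?_ ?_ fun j _ => ?_)
  · rw [count_U_steps, count_U_steps]
  · rw [count_D_steps, count_D_steps]
  · rw [← toSeq_apply, h, toSeq_apply]

/-- The word with `k` letters `D` and ascent sequence `x` that starts with a `D` if `k ≠ 0`. -/
def word (x : AscentSeq) : ℕ → List DyckStep
  | 0 => []
  -- For `k = 0` the difference is `x 0 - x 0`, so no `U` follows the last `D`.
  | k + 1 => D :: (List.replicate (x k - x (k - 1)) U ++ word x k)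

theorem count_D_word (x : AscentSeq) (k : ℕ) : (word x k).count D = k := by
  induction k with
  | zero => rfl
  | succ k ih => rw [word, List.count_cons_self, count_D_replicate_append, ih]

theorem count_U_word (x : AscentSeq) (k : ℕ) : (word x k).count U = x (k - 1) := by
  induction k with
  | zero => simp [word, x.zero]
  | succ k ih =>
    have := x.mono (Nat.sub_le k 1)
    rw [word, List.count_cons_of_ne (by decide), count_U_replicate_append, ih]
    simp only [Nat.add_sub_cancel]
    omega

theorem upsAfter_word (x : AscentSeq) {j k : ℕ} (h : j < k) : upsAfter (word x k) j = x j := by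
  induction k with
  | zero => omega
  | succ k ih =>
    have := x.mono (Nat.sub_le k 1)
    rw [word, upsAfter, count_D_replicate_append, count_D_word, upsAfter_replicate_append]
    split_ifs with h'
    · exact ih h'
    · obtain rfl : j = k := by omega
      rw [count_U_replicate_append, count_U_word]
      omega

theorem count_le_of_suffix_replicate {l : List DyckStep}
    (hl : ∀ s, s <:+ l → s.count U ≤ s.count D) {k : ℕ} (hk : k + l.count U ≤ l.count D) :
    ∀ s, s <:+ List.replicate k U ++ l → s.count U ≤ s.count D := by
  induction k with
  | zero => simpa using hl
  | succ k ih =>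
    intro s hs
    rw [List.replicate_succ, List.cons_append, List.suffix_cons_iff] at hs
    rcases hs with rfl | hs
    · rw [List.count_cons_self, List.count_cons_of_ne (by decide), count_U_replicate_append,
        count_D_replicate_append]
      omega
    · exact ih (by omega) s hs

theorem count_le_of_suffix_word (x : AscentSeq) (k : ℕ) :
    ∀ s, s <:+ word x k → s.count U ≤ s.count D := by
  induction k with
  | zero =>
    intro s hs
    rw [word, List.suffix_nil] at hs
    simp [hs]
  | succ k ih =>
    intro s hs
    have h₁ := count_U_word x (k + 1)
    have h₂ := count_D_word x (k + 1)
    have h₃ := count_U_word x k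
    have h₄ := count_D_word x k
    have h₅ := x.le_self k
    have h₆ := x.mono (Nat.sub_le k 1)
    have h₇ := x.le_self (k + 1 - 1)
    rw [word, List.suffix_cons_iff] at hs
    rcases hs with rfl | hs
    · rw [word] at h₁ h₂
      omega
    · exact count_le_of_suffix_replicate ih (by omega) s hs

/-- The Dyck path of size `n` with a given ascent sequence. -/
def ofSeq (n : ℕ) (x : AscentSeq) : DyckPath n :=
  -- The sequence prescribes `x (n - 1)` letters `U` behind the first `D`; the remaining ones
  -- precede it.
  ⟨{ toList := List.replicate (n - x (n - 1)) U ++ word x n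
     count_U_eq_count_D := by
      have := x.le_self (n - 1)
      rw [count_U_replicate_append, count_D_replicate_append, count_U_word, count_D_word]
      omega
     count_D_le_count_U := by
      intro i
      have := x.le_self (n - 1)
      have hU := count_U_replicate_append (n - x (n - 1)) (word x n)
      have hD := count_D_replicate_append (n - x (n - 1)) (word x n)
      rw [count_U_word] at hU
      rw [count_D_word] at hD
      have h := count_le_of_suffix_replicate (count_le_of_suffix_word x n)
        (k := n - x (n - 1)) (by rw [count_U_word, count_D_word]; omega) _ (List.drop_suffix i _)
      rw [← List.take_append_drop i (_ ++ _), List.count_append] at hU hD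
      omega }, by
    have := x.le_self (n - 1)
    change (List.replicate (n - x (n - 1)) U ++ word x n).count U = n
    rw [count_U_replicate_append, count_U_word]
    omega⟩

theorem toSeq_ofSeq (n : ℕ) (x : AscentSeq) : (ofSeq n x).toSeq = AscentSeq.trunc n x := by
  rw [← trunc_toSeq, AscentSeq.trunc_eq_iff]
  intro j hj
  change upsAfter (List.replicate (n - x (n - 1)) U ++ word x n) j = x j
  rw [upsAfter_replicate_append, upsAfter_word x hj]

theorem ofSeq_toSeq {n : ℕ} (P : DyckPath n) : ofSeq n P.toSeq = P :=
  toSeq_injective (by rw [toSeq_ofSeq, trunc_toSeq])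

theorem ofSeq_eq_iff {n : ℕ} {x y : AscentSeq} :
    ofSeq n x = ofSeq n y ↔ ∀ j < n, x j = y j := by
  rw [← AscentSeq.trunc_eq_iff, ← toSeq_ofSeq, ← toSeq_ofSeq, toSeq_injective.eq_iff]

/-- The first peak consists of the last `U` of the initial run and the first `D`. Its `U` lies
behind no `D`, and its `D` has the largest index, so the other terms stay unchanged. -/
theorem delPeak_eq_ofSeq (n : ℕ) (P : DyckPath (n + 1)) : delPeak n P = ofSeq n P.toSeq := by
  refine toSeq_injective ?_
  rw [toSeq_ofSeq, ← trunc_toSeq, AscentSeq.trunc_eq_iff]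
  intro j hj
  change upsAfter (deleteFirstPeak P.steps) j = upsAfter P.steps j
  have hD := P.count_D_steps
  have h1 := P.1.count_D_le_count_U 1
  change (P.steps.take 1).count D ≤ (P.steps.take 1).count U at h1
  obtain ⟨k, b, hb⟩ := eq_replicate_append_of_mem (l := P.steps)
    (List.count_pos_iff.1 (by omega))
  rw [hb] at hD h1 ⊢
  rw [count_D_replicate_append, List.count_cons_self] at hD
  rcases k with _ | k
  · simp at h1
  · have hdel : deleteFirstPeak (List.replicate (k + 1) U ++ D :: b) =
        List.replicate k U ++ b := by
      clear hb h1
      induction k with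
      | zero => rfl
      | succ k ih =>
        change deleteFirstPeak (U :: U :: (List.replicate k U ++ D :: b)) = _
        rw [deleteFirstPeak]
        · exact congrArg (List.cons U) ih
        · simp
    rw [hdel, upsAfter_replicate_append, upsAfter_replicate_append, upsAfter, if_pos (by omega)]

theorem toSeq_delPeak (n : ℕ) (P : DyckPath (n + 1)) :
    (delPeak n P).toSeq = AscentSeq.trunc n P.toSeq := by
  rw [delPeak_eq_ofSeq, toSeq_ofSeq]

/-! ### The ascent order in terms of ascent sequences -/

/-- The `D` that moves over `U^k` has index `b.count D + 1`; afterwards it has the same `U`s behind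
it as the next `D`. Conversely, every strict increase of the sequence comes from such a factor. -/
theorem ascentStep_iff {n : ℕ} {P Q : DyckPath n} :
    AscentStep P Q ↔ AscentSeq.IsStep n P.toSeq Q.toSeq := by
  have hD := P.count_D_steps
  have hU := P.count_U_steps
  have hD' := Q.count_D_steps
  have hU' := Q.count_U_steps
  constructor
  · rintro ⟨k, a, b, hk, hP, hQ⟩
    simp only [List.append_assoc, List.cons_append, List.nil_append] at hP hQ
    refine ⟨b.count D, ?_, ?_, fun i hi => ?_⟩
    · rw [hP] at hD
      simp [List.count_append, List.count_replicate] at hD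
      omega
    · rw [toSeq_apply, toSeq_apply, hP]
      exact upsAfter_ascent_lt k hk a b
    · rw [toSeq_apply, hQ, upsAfter_ascent (by rw [← hP]; omega), ← hP]
      rfl
  · rintro ⟨j, hj, hlt, h⟩
    obtain ⟨k, a, b, hk, hb, hP⟩ := exists_factor (l := P.steps) (by omega) hlt
    refine ⟨k, a, b, hk, by simpa using hP, ?_⟩
    rw [hP] at hD hU
    have hc : (a ++ (List.replicate k U ++ D :: D :: b)).count D = n := by
      rw [← hD]
      simp [List.count_append, List.count_replicate]
    refine eq_of_upsAfter_eq ?_ ?_ fun i hi => ?_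
    · rw [hU', ← hU]
      simp [List.count_append]
    · rw [hD', ← hc]
      simp
    · rw [List.append_assoc, List.append_assoc, ← toSeq_apply, h i (by omega),
        show [D, D] ++ b = D :: D :: b from rfl, upsAfter_ascent (by omega), ← hP, hb]
      rfl

theorem le_iff {n : ℕ} {P Q : DyckPath n} : P ≤ Q ↔ P.toSeq ≤ Q.toSeq := by
  constructor
  · intro h
    change Relation.ReflTransGen AscentStep P Q at h
    induction h with
    | refl => exact le_rfl
    | @tail R T _ hs ih =>
      obtain ⟨j, -, -, h⟩ := ascentStep_iff.1 hs
      refine ih.trans ?_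
      rw [← trunc_toSeq R, ← trunc_toSeq T, AscentSeq.trunc_eq_iff.2 h]
      exact AscentSeq.trunc_lower_le n _ j
  · intro h
    change Relation.ReflTransGen AscentStep P Q
    -- Each lowering strictly decreases the sum of the terms, so repeated lowering towards `Q`
    -- terminates.
    induction hN : ∑ j ∈ Finset.range n, P.toSeq j using Nat.strong_induction_on generalizing P with
    | _ N ih =>
      by_cases hPQ : P = Q
      · rw [hPQ]
      · obtain ⟨j, hj, hlt, hle⟩ := AscentSeq.exists_lower_le (n := n) (x := P.toSeq)
          (y := Q.toSeq) (by rwa [trunc_toSeq, trunc_toSeq])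
          (by rw [trunc_toSeq, trunc_toSeq]; exact fun h => hPQ (toSeq_injective h))
        have hR : ∀ i < n, (ofSeq n (P.toSeq.lower j)).toSeq i = P.toSeq.lower j i := by
          rw [← AscentSeq.trunc_eq_iff, trunc_toSeq, toSeq_ofSeq]
        refine Relation.ReflTransGen.head (b := ofSeq n (P.toSeq.lower j))
          (ascentStep_iff.2 ⟨j, hj, hlt, hR⟩) (ih _ ?_ ?_ rfl)
        · rw [← hN]
          refine Finset.sum_lt_sum (fun i hi => ?_) ⟨j + 1, Finset.mem_range.2 hj, ?_⟩
          · rw [hR i (Finset.mem_range.1 hi)]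
            by_cases hi' : i = j + 1
            · rw [hi', AscentSeq.lower_apply_self]
              exact hlt.le
            · rw [AscentSeq.lower_apply_of_ne _ hi']
          · rwa [hR _ hj, AscentSeq.lower_apply_self]
        · rwa [toSeq_ofSeq, ← trunc_toSeq Q]

theorem toSeq_mono {n : ℕ} : Monotone (toSeq (n := n)) := fun _ _ => le_iff.1

theorem ofSeq_mono (n : ℕ) : Monotone (ofSeq n) := fun x y h => by
  rw [le_iff, toSeq_ofSeq, toSeq_ofSeq]
  exact AscentSeq.trunc_mono n h

/-- The covering relation of the ascent order is the ascent step relation. -/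
theorem covBy_iff {n : ℕ} {P Q : DyckPath n} :
    P ⋖ Q ↔ AscentSeq.IsStep n P.toSeq Q.toSeq := by
  constructor
  · intro h
    have hle : Relation.ReflTransGen AscentStep P Q := h.le
    rcases Relation.ReflTransGen.cases_head hle with h' | ⟨R, hR, hRQ⟩
    · exact absurd h' h.ne
    · have hPR : P ≤ R := Relation.ReflTransGen.single hR
      rcases h.eq_or_eq hPR hRQ with rfl | rfl
      · exact absurd hR.weight_lt (lt_irrefl _)
      · exact ascentStep_iff.1 hR
  · intro h
    have hs := ascentStep_iff.2 h
    have hPQ : P ≤ Q := Relation.ReflTransGen.single hs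
    obtain ⟨j, hj, hlt, h⟩ := h
    have hne : P ≠ Q := fun h => absurd hs.weight_lt (by rw [h]; exact lt_irrefl _)
    refine ⟨lt_of_le_of_ne hPQ hne, fun R hPR hRQ => ?_⟩
    have h₁ := le_iff.1 hPR.le
    have h₂ := le_iff.1 hRQ.le
    -- The order reverses pointwise comparison, so `R` is squeezed wherever `P` and `Q` agree.
    have hoff : ∀ i < n, i ≠ j + 1 → P.toSeq i = R.toSeq i ∧ R.toSeq i = Q.toSeq i := by
      intro i hi hij
      have h₃ := AscentSeq.apply_le_of_le h₁ i
      have h₄ := AscentSeq.apply_le_of_le h₂ i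
      have h₅ := h i hi
      rw [AscentSeq.lower_apply_of_ne _ hij] at h₅
      omega
    -- This term of `R` occurs in `P` up to position `j + 1`, so it is `P.toSeq (j + 1)` or at most
    -- `P.toSeq j`, which is also its lower bound.
    have heq : R.toSeq (j + 1) = P.toSeq (j + 1) ∨ R.toSeq (j + 1) = Q.toSeq (j + 1) := by
      have h₄ := AscentSeq.apply_le_of_le h₂ (j + 1)
      have h₅ := h (j + 1) hj
      rw [AscentSeq.lower_apply_self] at h₅
      obtain ⟨i, hi, hRi⟩ := h₁ (j + 1)
      by_cases hij : i = j + 1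
      · exact Or.inl (by rw [hRi, hij])
      · have := P.toSeq.mono (show i ≤ j by omega)
        exact Or.inr (by omega)
    rcases heq with heq | heq
    · refine hPR.ne (toSeq_injective ?_)
      rw [← trunc_toSeq P, ← trunc_toSeq R, AscentSeq.trunc_eq_iff]
      intro i hi
      by_cases hij : i = j + 1
      · rw [hij, heq]
      · exact (hoff i hi hij).1
    · refine hRQ.ne (toSeq_injective ?_)
      rw [← trunc_toSeq Q, ← trunc_toSeq R, AscentSeq.trunc_eq_iff]
      intro i hi
      by_cases hij : i = j + 1
      · rw [hij, heq]
      · exact (hoff i hi hij).2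

end DyckPath

/-! ### Connectedness in graphs -/

open TopologicalSpace Filter Topology

/-- If no edge joined the two parts, every fibre would lie within one of them, so the parts would be
unions of fibres. An edge between their images in `S` then lifts to an edge between the parts. -/
theorem isMonotoneGraphEpi_of_fibre_connected {X Y : Type*} [TopologicalSpace X]
    [DiscreteTopology X] [TopologicalSpace Y] [DiscreteTopology Y] {E : X → X → Prop}
    {E' : Y → Y → Prop} {f : X → Y} (hf : IsRelEpi E E' f)
    (hfib : ∀ y, GraphConnected E {x | f x = y}) : IsMonotoneGraphEpi E E' f where
  continuous := continuous_of_discreteTopology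
  epi := hf
  preimage_connected S _ hS F G _ _ hcov hF hG := by
    by_contra hno
    push Not at hno
    have hfibre : ∀ y ∈ S, ∀ a b, f a = y → f b = y → a ∈ F → b ∈ G → False := by
      intro y hy a b ha hb haF hbG
      obtain ⟨c, hc, d, hd, hcd⟩ := hfib y F G (isClosed_discrete _) (isClosed_discrete _)
        (fun x hx => hcov (by rw [Set.mem_preimage, show f x = y from hx]; exact hy))
        ⟨a, ha, haF⟩ ⟨b, hb, hbG⟩
      have hmem : ∀ x, f x = y → x ∈ f ⁻¹' S := fun x hx => by rwa [Set.mem_preimage, hx]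
      exact hno c ⟨hmem c hc.1, hc.2⟩ d ⟨hmem d hd.1, hd.2⟩ hcd
    obtain ⟨_, ⟨hcS, a', ha', rfl⟩, _, ⟨hdS, b', hb', rfl⟩, hcd⟩ := hS (f '' F) (f '' G)
      (isClosed_discrete _) (isClosed_discrete _)
      (fun y hy => by
        obtain ⟨x, rfl⟩ := hf.surjective y
        exact (hcov hy).imp (Set.mem_image_of_mem f) (Set.mem_image_of_mem f))
      (let ⟨x, hx⟩ := hF; ⟨f x, hx.1, x, hx.2, rfl⟩) (let ⟨x, hx⟩ := hG; ⟨f x, hx.1, x, hx.2, rfl⟩)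
    obtain ⟨a, b, hab, ha, hb⟩ := hf.rel_surjective _ _ hcd
    have haS : a ∈ f ⁻¹' S := by rwa [Set.mem_preimage, ha]
    have hbS : b ∈ f ⁻¹' S := by rwa [Set.mem_preimage, hb]
    have haF : a ∈ F := (hcov haS).resolve_right fun h => hfibre _ hcS a' a rfl ha ha' h
    have hbG : b ∈ G := (hcov hbS).resolve_left fun h => hfibre _ hdS b b' hb rfl h hb'
    exact hno a ⟨haS, haF⟩ b ⟨hbS, hbG⟩ hab

/-- A set in which some vertex is joined to all others is connected. -/
theorem graphConnected_of_star {X : Type*} [TopologicalSpace X] {E : X → X → Prop}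
    (hsymm : ∀ x y, E x y → E y x) {S : Set X} {c : X} (hc : c ∈ S) (h : ∀ x ∈ S, E c x) :
    GraphConnected E S := by
  rintro F G - - hcov ⟨a, haS, haF⟩ ⟨b, hbS, hbG⟩
  rcases hcov hc with hcF | hcG
  · exact ⟨c, ⟨hc, hcF⟩, b, ⟨hbS, hbG⟩, h b hbS⟩
  · exact ⟨a, ⟨haS, haF⟩, c, ⟨hc, hcG⟩, hsymm _ _ (h a haS)⟩

/-! ### Inverse limits of finite graphs -/

namespace InverseLimit

variable {F : ℕ → Type} {α : ∀ n, F (n + 1) → F n}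

/-- The edge relation of the inverse limit: edges in every coordinate. -/
def Edge (E : ∀ n, F n → F n → Prop) (x y : InverseLimit F α) : Prop := ∀ n, E n (x.1 n) (y.1 n)

theorem coord_eq_of_le {x y : InverseLimit F α} {m n : ℕ} (hmn : m ≤ n) (h : x.1 n = y.1 n) :
    x.1 m = y.1 m := by
  induction n, hmn using Nat.le_induction with
  | base => exact h
  | succ n _ ih => exact ih (by rw [← x.2 n, ← y.2 n, h])

theorem coord_rel_of_le {E : ∀ n, F n → F n → Prop}
    (hα : ∀ n a b, E (n + 1) a b → E n (α n a) (α n b)) {x y : InverseLimit F α} {m n : ℕ}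
    (hmn : m ≤ n) (h : E n (x.1 n) (y.1 n)) : E m (x.1 m) (y.1 m) := by
  induction n, hmn using Nat.le_induction with
  | base => exact h
  | succ n _ ih => exact ih (by rw [← x.2 n, ← y.2 n]; exact hα n _ _ h)

variable [∀ n, TopologicalSpace (F n)]

theorem continuous_coord (n : ℕ) : Continuous fun x : InverseLimit F α => x.1 n :=
  (continuous_apply n).comp continuous_subtype_val

variable [∀ n, DiscreteTopology (F n)]

theorem isClosed_range_coord : IsClosed {x : ∀ n, F n | ∀ n, α n (x (n + 1)) = x n} := by
  rw [Set.ofPred_forall]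
  exact isClosed_iInter fun n => isClosed_eq
    (continuous_of_discreteTopology.comp (continuous_apply _)) (continuous_apply _)

theorem isClopen_preimage_coord (n : ℕ) (C : Set (F n)) :
    IsClopen {x : InverseLimit F α | x.1 n ∈ C} :=
  (isClopen_discrete C).preimage (continuous_coord n)

theorem isClosed_coord_rel (n : ℕ) (r : F n → F n → Prop) :
    IsClosed {p : InverseLimit F α × InverseLimit F α | r (p.1.1 n) (p.2.1 n)} :=
  (isClosed_discrete {q : F n × F n | r q.1 q.2}).preimage
    (((continuous_coord n).comp continuous_fst).prodMk ((continuous_coord n).comp continuous_snd))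

variable [∀ n, Finite (F n)]

instance : CompactSpace (InverseLimit F α) :=
  isCompact_iff_compactSpace.1 isClosed_range_coord.isCompact

instance : SecondCountableTopology (InverseLimit F α) :=
  TopologicalSpace.Subtype.secondCountableTopology _

theorem isTopologicalGraph {E : ∀ n, F n → F n → Prop} (hrefl : ∀ n a, E n a a)
    (hsymm : ∀ n a b, E n a b → E n b a) :
    IsTopologicalGraph (Edge (α := α) E) where
  compact := inferInstance
  hausdorff := inferInstance
  zeroDim := isTopologicalBasis_isClopen
  secondCountable := inferInstance
  refl _ n := hrefl n _
  symm _ _ h n := hsymm n _ _ (h n)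
  closed := by
    simp only [Edge, Set.ofPred_forall]
    exact isClosed_iInter fun n => isClosed_coord_rel n (E n)

/-- In an inverse limit of monotone epimorphisms, preimages of connected sets under the
projections are connected. -/
theorem graphConnected_preimage {E : ∀ n, F n → F n → Prop}
    (hsurj : ∀ n a, ∃ x : InverseLimit F α, x.1 n = a)
    (hmono : ∀ n, IsMonotoneGraphEpi (E (n + 1)) (E n) (α n)) {n : ℕ} {C : Set (F n)}
    (hC : GraphConnected (E n) C) :
    GraphConnected (Edge E) {x : InverseLimit F α | x.1 n ∈ C} := by
  set S := {x : InverseLimit F α | x.1 n ∈ C} with hSdef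
  have hSclosed : IsClosed S := (isClopen_preimage_coord n C).isClosed
  have himage : ∀ N, n ≤ N → GraphConnected (E N) ((fun x : InverseLimit F α => x.1 N) '' S) := by
    intro N hN
    induction N, hN using Nat.le_induction with
    | base =>
      convert hC
      ext a
      constructor
      · rintro ⟨x, hx, rfl⟩
        exact hx
      · intro ha
        obtain ⟨x, rfl⟩ := hsurj n a
        exact ⟨x, ha, rfl⟩
    | succ N hN ih =>
      convert (hmono N).preimage_connected _ (isClosed_discrete _) ih
      ext a
      constructor
      · rintro ⟨x, hx, rfl⟩
        exact ⟨x, hx, (x.2 N).symm⟩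
      · rintro ⟨x, hx, hxa⟩
        obtain ⟨y, rfl⟩ := hsurj (N + 1) a
        refine ⟨y, ?_, rfl⟩
        have : x.1 N = y.1 N := hxa.trans (y.2 N)
        rw [hSdef, Set.mem_ofPred_eq, ← coord_eq_of_le hN this]
        exact hx
  intro A B hA hB hcov ⟨a₀, ha₀⟩ ⟨b₀, hb₀⟩
  have hmap : ∀ n a b, E (n + 1) a b → E n (α n a) (α n b) := fun n => (hmono n).epi.map_rel
  -- Each finite level supplies an edge between the images of the two parts. The pairs joined at
  -- level `n + i` form a decreasing sequence of nonempty compact sets, and a common pair is joined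
  -- at every level.
  let T : ℕ → Set (InverseLimit F α × InverseLimit F α) := fun i =>
    ((S ∩ A) ×ˢ (S ∩ B)) ∩ {p | E (n + i) (p.1.1 (n + i)) (p.2.1 (n + i))}
  have hTclosed : ∀ i, IsClosed (T i) := fun i =>
    ((hSclosed.inter hA).prod (hSclosed.inter hB)).inter (isClosed_coord_rel _ _)
  obtain ⟨p, hp⟩ := IsCompact.nonempty_iInter_of_sequence_nonempty_isCompact_isClosed T
    (fun i p hp => ⟨hp.1, coord_rel_of_le hmap (by omega) hp.2⟩)
    (fun i => by
      obtain ⟨_, ⟨-, a, ha, rfl⟩, _, ⟨-, b, hb, rfl⟩, hab⟩ := himage (n + i) (Nat.le_add_right _ _)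
        ((fun x => x.1 (n + i)) '' (S ∩ A)) ((fun x => x.1 (n + i)) '' (S ∩ B))
        (isClosed_discrete _) (isClosed_discrete _)
        (by
          rintro _ ⟨x, hx, rfl⟩
          exact (hcov hx).imp (fun h => ⟨x, ⟨hx, h⟩, rfl⟩) (fun h => ⟨x, ⟨hx, h⟩, rfl⟩))
        ⟨_, ⟨a₀, ha₀.1, rfl⟩, a₀, ha₀, rfl⟩ ⟨_, ⟨b₀, hb₀.1, rfl⟩, b₀, hb₀, rfl⟩
      exact ⟨(a, b), ⟨ha, hb⟩, hab⟩)
    (hTclosed 0).isCompact hTclosed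
  rw [Set.mem_iInter] at hp
  exact ⟨p.1, (hp 0).1.1, p.2, (hp 0).1.2, fun m => coord_rel_of_le hmap (by omega) (hp m).2⟩

/-- Closed sets are the intersections of their cylinders. -/
theorem exists_cylinder_subset {K U : Set (InverseLimit F α)} (hK : IsClosed K) (hU : IsOpen U)
    (hKU : K ⊆ U) :
    ∃ n, {x : InverseLimit F α | ∃ z ∈ K, z.1 n = x.1 n} ⊆ U := by
  have hclosed : ∀ n, IsClosed {x : InverseLimit F α | ∃ z ∈ K, z.1 n = x.1 n} := fun n =>
    (isClopen_preimage_coord n ((fun z : InverseLimit F α => z.1 n) '' K)).isClosed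
  refine exists_subset_nhds_of_isCompact' (directed_of_isDirected_le ?_)
    (fun n => (hclosed n).isCompact) hclosed fun x hx => hU.mem_nhds (hKU ?_)
  · rintro m n hmn x ⟨z, hz, h⟩
    exact ⟨z, hz, coord_eq_of_le hmn h⟩
  · rw [Set.mem_iInter] at hx
    -- The points of `K` agreeing with `x` at level `n` form nested nonempty compact sets; a common
    -- point must be `x`.
    obtain ⟨z, hz⟩ := IsCompact.nonempty_iInter_of_sequence_nonempty_isCompact_isClosed
      (fun n => K ∩ {z : InverseLimit F α | z.1 n ∈ ({x.1 n} : Set (F n))})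
      (fun n z hz => ⟨hz.1, coord_eq_of_le n.le_succ hz.2⟩)
      (fun n => by
        obtain ⟨z, hz, h⟩ := hx n
        exact ⟨z, hz, h⟩)
      (hK.inter (isClopen_preimage_coord _ _).isClosed).isCompact
      (fun n => hK.inter (isClopen_preimage_coord _ _).isClosed)
    rw [Set.mem_iInter] at hz
    have hzx : z = x := Subtype.ext (funext fun n => (hz n).2)
    exact hzx ▸ (hz 0).1

/-- An inverse limit of monotone epimorphisms of finite graphs is Kelley. -/
theorem isKelley {E : ∀ n, F n → F n → Prop} (hrefl : ∀ n a, E n a a)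
    (hsymm : ∀ n a b, E n a b → E n b a)
    (hsurj : ∀ n a, ∃ x : InverseLimit F α, x.1 n = a)
    (hmono : ∀ n, IsMonotoneGraphEpi (E (n + 1)) (E n) (α n)) [Subsingleton (F 0)] :
    IsKelley (Edge (α := α) E) where
  isTopologicalGraph := isTopologicalGraph hrefl hsymm
  connected := by
    convert graphConnected_preimage (n := 0) (C := Set.univ) hsurj hmono ?_
    · simp
    · rintro A B - - - ⟨a, ha⟩ ⟨b, hb⟩
      exact ⟨a, ha, b, hb, Subsingleton.elim a b ▸ hrefl 0 a⟩
  kelley K hK p hp u hu := by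
    classical
    -- The deepest level at which `u m` and `p` agree, capped at `m` since they may be equal; level
    -- `0`, a single vertex, always qualifies.
    let k : ℕ → ℕ := fun m => Nat.findGreatest (fun n => (u m).1 n = p.1 n) m
    have hk : ∀ m, (u m).1 (k m) = p.1 (k m) := fun m =>
      Nat.findGreatest_spec (P := fun n => (u m).1 n = p.1 n) (Nat.zero_le m)
        (Subsingleton.elim _ _)
    have hkN : ∀ N, ∀ᶠ m in atTop, N ≤ k m := by
      intro N
      have h := hu.eventually
        ((isClopen_preimage_coord N {p.1 N}).isOpen.mem_nhds (Set.mem_singleton (p.1 N)))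
      filter_upwards [h, eventually_ge_atTop N] with m hm hNm
      exact Nat.le_findGreatest hNm hm
    have hcyl : ∀ n, IsCompact {x : InverseLimit F α | ∃ z ∈ K, z.1 n = x.1 n} := fun n =>
      (isClopen_preimage_coord n
        ((fun z : InverseLimit F α => z.1 n) '' (K : Set _))).isClosed.isCompact
    let L : ℕ → NonemptyCompacts (InverseLimit F α) := fun m =>
      ⟨⟨_, hcyl (k m)⟩, ⟨p, p, hp, rfl⟩⟩
    have hKL : ∀ m, (K : Set (InverseLimit F α)) ⊆ L m := fun m x hx => ⟨x, hx, rfl⟩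
    refine ⟨L, fun m => ?_, fun m => ⟨p, hp, (hk m).symm⟩, ?_⟩
    · refine graphConnected_preimage (n := k m)
        (C := (fun z : InverseLimit F α => z.1 (k m)) '' (K : Set _)) hsurj hmono ?_
      rintro A B - - hcov ⟨_, ⟨a, ha, rfl⟩, haA⟩ ⟨_, ⟨b, hb, rfl⟩, hbB⟩
      obtain ⟨a, ha, b, hb, hab⟩ := hK {x | x.1 (k m) ∈ A} {x | x.1 (k m) ∈ B}
        (isClopen_preimage_coord _ _).isClosed (isClopen_preimage_coord _ _).isClosed
        (fun x hx => hcov ⟨x, hx, rfl⟩) ⟨a, ha, haA⟩ ⟨b, hb, hbB⟩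
      exact ⟨_, ⟨⟨a, ha.1, rfl⟩, ha.2⟩, _, ⟨⟨b, hb.1, rfl⟩, hb.2⟩, hab _⟩
    · let := TopologicalSpace.vietoris (InverseLimit F α)
      rw [(NonemptyCompacts.isEmbedding_coe (α := InverseLimit F α)).tendsto_nhds_iff, tendsto_nhds_generateFrom_iff]
      -- Subbasic Vietoris sets: lying inside `U` holds eventually because the cylinders shrink to
      -- `K`; meeting `V` always holds because they contain `K`.
      rintro _ (⟨U, hU, rfl⟩ | ⟨V, -, rfl⟩) hKU
      · obtain ⟨N, hN⟩ := exists_cylinder_subset K.isCompact.isClosed hU hKU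
        filter_upwards [hkN N] with m hm
        rintro x ⟨z, hz, h⟩
        exact hN ⟨z, hz, coord_eq_of_le hm h⟩
      · exact Eventually.of_forall fun m => hKU.mono (Set.inter_subset_inter_left _ (hKL m))

end InverseLimit

/-! ### Lattices by retraction -/

/-- Applying `r` to the inequalities for joins and meets in `β` gives those in `α`, since `r ∘ s` is
the identity; no adjunction is needed. -/
theorem isLatticeOrder_of_retract {α β : Type*} [inst : PartialOrder α] [Lattice β] {s : α → β}
    {r : β → α} (hs : Monotone s) (hr : Monotone r) (hrs : ∀ a, r (s a) = a) :
    IsLatticeOrder α :=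
  ⟨{ inst with
      sup := fun a b => r (s a ⊔ s b)
      inf := fun a b => r (s a ⊓ s b)
      le_sup_left := fun a b => by
        have := hr (le_sup_left : s a ≤ s a ⊔ s b)
        rwa [hrs] at this
      le_sup_right := fun a b => by
        have := hr (le_sup_right : s b ≤ s a ⊔ s b)
        rwa [hrs] at this
      sup_le := fun a b c hac hbc => by
        have := hr (sup_le (hs hac) (hs hbc))
        rwa [hrs] at this
      inf_le_left := fun a b => by
        have := hr (inf_le_left : s a ⊓ s b ≤ s a)
        rwa [hrs] at this
      inf_le_right := fun a b => by
        have := hr (inf_le_right : s a ⊓ s b ≤ s b)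
        rwa [hrs] at this
      le_inf := fun a b c hab hac => by
        have := hr (le_inf (hs hab) (hs hac))
        rwa [hrs] at this }, rfl⟩

/-- A lattice is not distributive if it contains a pentagon. -/
theorem IsLatticeOrder.isNonDistributiveLattice {α : Type*} [inst : PartialOrder α]
    (h : IsLatticeOrder α) {x y z : α} (hyx : y < x) (hsup : ∀ u, y ≤ u → z ≤ u → x ≤ u)
    (hinf : ∀ w, w ≤ x → w ≤ z → w ≤ y) : IsNonDistributiveLattice α := by
  obtain ⟨L, rfl⟩ := h
  refine ⟨L, rfl, x, y, z, fun h => hyx.not_ge ?_⟩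
  change x ⊓ (y ⊔ z) = (x ⊓ y) ⊔ (x ⊓ z) at h
  rw [inf_eq_left.2 (hsup _ le_sup_left le_sup_right), inf_eq_right.2 hyx.le,
    sup_eq_left.2 (hinf _ inf_le_left inf_le_right)] at h
  exact h.le

/-- The pentagon is described by bounds alone, so it passes to `α` although `r` need not preserve
joins or meets. -/
theorem isNonDistributiveLattice_of_retract {α β : Type*} [PartialOrder α] [Lattice β]
    {s : α → β} {r : β → α} (hs : Monotone s) (hr : Monotone r) (hrs : ∀ a, r (s a) = a)
    {x y z : β} (hx : s (r x) = x) (hy : s (r y) = y) (hz : s (r z) = z) (hyx : y < x)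
    (hsup : ∀ u, y ≤ u → z ≤ u → x ≤ u) (hinf : ∀ w, w ≤ x → w ≤ z → w ≤ y) :
    IsNonDistributiveLattice α := by
  have hle : ∀ {a : α} {b : β}, s a ≤ b → a ≤ r b := fun {a b} h => hrs a ▸ hr h
  have hle' : ∀ {a : α} {b : β}, b ≤ s a → r b ≤ a := fun {a b} h => hrs a ▸ hr h
  refine (isLatticeOrder_of_retract hs hr hrs).isNonDistributiveLattice (x := r x) (y := r y)
    (z := r z) ((hr hyx.le).lt_of_ne fun h => hyx.ne ?_) (fun u hyu hzu => ?_)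
    (fun w hwx hwz => ?_)
  · rw [← hy, h, hx]
  · exact hle' (hsup _ (hy ▸ hs hyu) (hz ▸ hs hzu))
  · exact hle (hinf _ (hx ▸ hs hwx) (hz ▸ hs hwz))

/-! ### A pentagon among the ascent sequences -/

namespace AscentSeq

/-- The sequence `0, a, b, b, …`. -/
def ofTwo (a b : ℕ) (ha : a ≤ 1) (hab : a ≤ b) (hb : b ≤ 2) : AscentSeq :=
  ⟨fun j => if j = 0 then 0 else if j = 1 then a else b,
    fun i j h => by dsimp only; split_ifs <;> omega,
    fun j => by dsimp only; split_ifs <;> omega⟩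

theorem trunc_ofTwo {n : ℕ} (hn : 3 ≤ n) {a b : ℕ} (ha : a ≤ 1) (hab : a ≤ b) (hb : b ≤ 2) :
    trunc n (ofTwo a b ha hab hb) = ofTwo a b ha hab hb := by
  refine ext fun j => ?_
  rw [trunc_apply]
  simp only [ofTwo]
  split_ifs <;> omega

/-- The ascent sequences contain a pentagon, formed by `0,0,1,1,…`, `0,1,1,1,…` and
`0,0,2,2,…`. -/
theorem pentagon :
    ofTwo 1 1 (by omega) (by omega) (by omega) < ofTwo 0 1 (by omega) (by omega) (by omega) ∧
    (∀ u, ofTwo 1 1 (by omega) (by omega) (by omega) ≤ u →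
      ofTwo 0 2 (by omega) (by omega) (by omega) ≤ u →
      ofTwo 0 1 (by omega) (by omega) (by omega) ≤ u) ∧
    (∀ w, w ≤ ofTwo 0 1 (by omega) (by omega) (by omega) →
      w ≤ ofTwo 0 2 (by omega) (by omega) (by omega) →
      w ≤ ofTwo 1 1 (by omega) (by omega) (by omega)) := by
  refine ⟨lt_of_le_of_ne (fun j => ?_) fun h => ?_, fun u h₁ h₂ j => ?_, fun w h₁ h₂ j => ?_⟩
  · by_cases hj : j = 1
    · exact ⟨0, Nat.zero_le _, by simp [ofTwo, hj]⟩
    · exact ⟨j, le_rfl, by simp [ofTwo, hj]⟩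
  · have := congrArg (fun x : AscentSeq => x 1) h
    simp [ofTwo] at this
  -- A term of `u` lies in both `{0, 1}` and `{0, 2}`, hence is `0`.
  · obtain ⟨i, -, hi⟩ := h₁ j
    obtain ⟨k, -, hk⟩ := h₂ j
    refine ⟨0, Nat.zero_le _, ?_⟩
    simp only [ofTwo] at hi hk ⊢
    split_ifs at * <;> omega
  · obtain ⟨i, hi, hwi⟩ := h₁ 2
    obtain ⟨k, hk, hwk⟩ := h₂ 2
    simp only [ofTwo] at hwi hwk
    norm_num at hwi hwk
    have hw := w.le_self k
    -- The value `2` cannot occur before position `2`, so `w 2 = 2` and the value `1` must occur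
    -- earlier.
    have hi' : i ≤ 1 := by
      by_contra hcon
      have := w.mono (show k ≤ i by omega)
      omega
    rcases Nat.eq_zero_or_pos j with rfl | hj
    · exact ⟨0, le_rfl, by rw [zero, zero]⟩
    · refine ⟨i, by omega, ?_⟩
      simp only [ofTwo]
      split_ifs <;> omega

end AscentSeq

/-! ### The poset and the graph `D_n` -/

namespace DyckPath

theorem isLatticeOrder (n : ℕ) : IsLatticeOrder (DyckPath n) :=
  isLatticeOrder_of_retract toSeq_mono (ofSeq_mono n) ofSeq_toSeq

theorem isNonDistributiveLattice {n : ℕ} (hn : 3 ≤ n) : IsNonDistributiveLattice (DyckPath n) := by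
  obtain ⟨h₁, h₂, h₃⟩ := AscentSeq.pentagon
  refine isNonDistributiveLattice_of_retract toSeq_mono (ofSeq_mono n) ofSeq_toSeq
    ?_ ?_ ?_ h₁ h₂ h₃ <;> rw [toSeq_ofSeq, AscentSeq.trunc_ofTwo hn]

theorem delPeak_ofSeq (n : ℕ) (x : AscentSeq) : delPeak n (ofSeq (n + 1) x) = ofSeq n x := by
  rw [delPeak_eq_ofSeq, toSeq_ofSeq, ofSeq_eq_iff]
  intro j hj
  exact AscentSeq.trunc_apply_of_lt _ (by omega)

/-- Repeating the last term is a monotone section, which lifts comparable pairs. -/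
theorem isRelEpi_le_delPeak (n : ℕ) :
    IsRelEpi (fun P Q : DyckPath (n + 1) => P ≤ Q) (fun P Q : DyckPath n => P ≤ Q)
      (delPeak n) where
  map_rel P Q h := by
    rw [delPeak_eq_ofSeq, delPeak_eq_ofSeq]
    exact ofSeq_mono n (toSeq_mono h)
  surjective Q := ⟨ofSeq (n + 1) Q.toSeq, by rw [delPeak_ofSeq, ofSeq_toSeq]⟩
  rel_surjective P Q h := ⟨ofSeq (n + 1) P.toSeq, ofSeq (n + 1) Q.toSeq,
    ofSeq_mono _ (toSeq_mono h), by rw [delPeak_ofSeq, ofSeq_toSeq],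
    by rw [delPeak_ofSeq, ofSeq_toSeq]⟩

theorem hasseEdge_symm {β : Type*} [PartialOrder β] (a b : β) (h : HasseEdge a b) :
    HasseEdge b a := h.imp Eq.symm SimpleGraph.Adj.symm

theorem hasseEdge_of_isStep {n : ℕ} {P Q : DyckPath n}
    (h : AscentSeq.IsStep n P.toSeq Q.toSeq) : HasseEdge P Q :=
  Or.inr (SimpleGraph.hasse_adj.2 (Or.inl (covBy_iff.2 h)))

/-- A step at a surviving position remains a step; a step at the forgotten position `n` collapses to
a loop. -/
theorem hasseEdge_delPeak_of_isStep {n : ℕ} {P Q : DyckPath (n + 1)}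
    (h : AscentSeq.IsStep (n + 1) P.toSeq Q.toSeq) :
    HasseEdge (delPeak n P) (delPeak n Q) := by
  obtain ⟨j, hj, hlt, h⟩ := h
  by_cases hjn : j + 1 < n
  · refine hasseEdge_of_isStep ⟨j, hjn, ?_, fun i hi => ?_⟩
    · rwa [toSeq_delPeak, AscentSeq.trunc_apply_of_lt _ hjn,
        AscentSeq.trunc_apply_of_lt _ (by omega)]
    · rw [toSeq_delPeak, toSeq_delPeak, AscentSeq.trunc_apply_of_lt _ hi, h i (by omega)]
      by_cases hij : i = j + 1
      · rw [hij, AscentSeq.lower_apply_self, AscentSeq.lower_apply_self,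
          AscentSeq.trunc_apply_of_lt _ (by omega)]
      · rw [AscentSeq.lower_apply_of_ne _ hij, AscentSeq.lower_apply_of_ne _ hij,
          AscentSeq.trunc_apply_of_lt _ hi]
  · refine Or.inl ?_
    rw [delPeak_eq_ofSeq, delPeak_eq_ofSeq, ofSeq_eq_iff]
    intro i hi
    rw [h i (by omega), AscentSeq.lower_apply_of_ne _ (by omega)]

end DyckPath

/-! ### Lifting Hasse edges and connectedness of the fibres -/

namespace AscentSeq

/-- Replace the terms from position `n` on by the largest possible values. -/
def raise (n : ℕ) (x : AscentSeq) : AscentSeq :=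
  ⟨fun j => if j < n then x j else j, by
    intro i j h
    have h₁ := x.mono h
    have h₂ := x.le_self i
    dsimp only
    split_ifs <;> omega, fun j => by
    have := x.le_self j
    dsimp only
    split_ifs <;> omega⟩

theorem raise_apply_of_lt {n j : ℕ} (h : j < n) (x : AscentSeq) : raise n x j = x j := if_pos h

theorem raise_apply_of_le {n j : ℕ} (h : n ≤ j) (x : AscentSeq) : raise n x j = j :=
  if_neg (by omega)

/-- The new term `n` does not depend on the sequence, so still only one term changes. Repeating the
last term would fail here, because lowering the last term would change two. -/
theorem IsStep.raise {n : ℕ} {x y : AscentSeq} (h : IsStep n x y) :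
    IsStep (n + 1) (raise n x) (raise n y) := by
  obtain ⟨j, hj, hlt, h⟩ := h
  refine ⟨j, by omega, ?_, fun i hi => ?_⟩
  · rwa [raise_apply_of_lt hj, raise_apply_of_lt (by omega)]
  · by_cases hij : i = j + 1
    · rw [hij, lower_apply_self, raise_apply_of_lt hj, h _ hj, raise_apply_of_lt (by omega),
        lower_apply_self]
    · rw [lower_apply_of_ne _ hij]
      rcases Nat.lt_or_ge i n with hin | hin
      · rw [raise_apply_of_lt hin, raise_apply_of_lt hin, h _ hin, lower_apply_of_ne _ hij]
      · rw [raise_apply_of_le hin, raise_apply_of_le hin]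

theorem IsStep.congr {n : ℕ} {x y x' y' : AscentSeq} (h : IsStep n x y)
    (hx : ∀ i < n, x' i = x i) (hy : ∀ i < n, y' i = y i) : IsStep n x' y' := by
  obtain ⟨j, hj, hlt, h⟩ := h
  refine ⟨j, hj, by rwa [hx j (by omega), hx _ hj], fun i hi => ?_⟩
  rw [hy i hi, h i hi]
  by_cases hij : i = j + 1
  · rw [hij, lower_apply_self, lower_apply_self, hx j (by omega)]
  · rw [lower_apply_of_ne _ hij, lower_apply_of_ne _ hij, hx i hi]

end AscentSeq

namespace DyckPath

theorem delPeak_ofSeq_raise {n : ℕ} (P : DyckPath n) :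
    delPeak n (ofSeq (n + 1) (P.toSeq.raise n)) = P := by
  refine Eq.trans ?_ (ofSeq_toSeq P)
  rw [delPeak_ofSeq, ofSeq_eq_iff]
  exact fun j hj => AscentSeq.raise_apply_of_lt hj _

theorem isStep_ofSeq_raise {n : ℕ} {P Q : DyckPath n}
    (h : AscentSeq.IsStep n P.toSeq Q.toSeq) :
    AscentSeq.IsStep (n + 1) (ofSeq (n + 1) (P.toSeq.raise n)).toSeq
      (ofSeq (n + 1) (Q.toSeq.raise n)).toSeq := by
  rw [toSeq_ofSeq, toSeq_ofSeq]
  exact h.raise.congr (fun i hi => AscentSeq.trunc_apply_of_lt _ hi)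
    (fun i hi => AscentSeq.trunc_apply_of_lt _ hi)

theorem hasseEdge_ofSeq_raise {n : ℕ} {P Q : DyckPath n} (h : HasseEdge P Q) :
    HasseEdge (ofSeq (n + 1) (P.toSeq.raise n)) (ofSeq (n + 1) (Q.toSeq.raise n)) := by
  rcases h with rfl | h
  · exact Or.inl rfl
  · rcases SimpleGraph.hasse_adj.1 h with h | h
    · exact hasseEdge_of_isStep (isStep_ofSeq_raise (covBy_iff.1 h))
    · exact hasseEdge_symm _ _ (hasseEdge_of_isStep (isStep_ofSeq_raise (covBy_iff.1 h)))

theorem isRelEpi_hasseEdge_delPeak (n : ℕ) :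
    IsRelEpi (HasseEdge (α := DyckPath (n + 1))) (HasseEdge (α := DyckPath n)) (delPeak n) where
  map_rel P Q h := by
    rcases h with rfl | h
    · exact Or.inl rfl
    · rcases SimpleGraph.hasse_adj.1 h with h | h
      · exact hasseEdge_delPeak_of_isStep (covBy_iff.1 h)
      · exact hasseEdge_symm _ _ (hasseEdge_delPeak_of_isStep (covBy_iff.1 h))
  surjective Q := ⟨_, delPeak_ofSeq_raise Q⟩
  rel_surjective _ _ h := ⟨_, _, hasseEdge_ofSeq_raise h, delPeak_ofSeq_raise _,
    delPeak_ofSeq_raise _⟩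

/-- The fibres of `delPeak` are stars; the centre over `Q` is the path whose ascent sequence
repeats the last term of that of `Q`. -/
theorem graphConnected_fibre_delPeak (n : ℕ) (Q : DyckPath n) :
    GraphConnected HasseEdge {P : DyckPath (n + 1) | delPeak n P = Q} := by
  have hc : delPeak n (ofSeq (n + 1) Q.toSeq) = Q := by rw [delPeak_ofSeq, ofSeq_toSeq]
  refine graphConnected_of_star hasseEdge_symm hc fun P hP => ?_
  have hPQ : ∀ i < n, Q.toSeq i = P.toSeq i := by
    change delPeak n P = Q at hP
    rw [← AscentSeq.trunc_eq_iff, ← toSeq_delPeak, hP, trunc_toSeq]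
  have hC : ∀ i < n + 1, (ofSeq (n + 1) Q.toSeq).toSeq i = Q.toSeq i := fun i hi => by
    rw [toSeq_ofSeq, AscentSeq.trunc_apply_of_lt _ hi]
  by_cases h : P.toSeq n = Q.toSeq n
  · refine Or.inl ?_
    rw [← ofSeq_toSeq P, ofSeq_eq_iff]
    intro i hi
    rcases Nat.lt_succ_iff_lt_or_eq.1 hi with hi | rfl
    · exact hPQ i hi
    · exact h.symm
  · rcases n with _ | n
    · exact absurd (by rw [AscentSeq.zero, AscentSeq.zero]) h
    · have hn : Q.toSeq (n + 1) = P.toSeq n := by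
        rw [← hPQ n (by omega), ← trunc_toSeq Q, AscentSeq.trunc_apply, AscentSeq.trunc_apply]
        simp
      have := P.toSeq.mono (show n ≤ n + 1 by omega)
      refine hasseEdge_symm _ _ (hasseEdge_of_isStep ⟨n, by omega, by omega, fun i hi => ?_⟩)
      rw [hC i hi]
      by_cases hin : i = n + 1
      · rw [hin, AscentSeq.lower_apply_self, hn]
      · rw [AscentSeq.lower_apply_of_ne _ hin, hPQ i (by omega)]

theorem isMonotoneGraphEpi_delPeak (n : ℕ) :
    IsMonotoneGraphEpi (X := DyckPath (n + 1)) (Y := DyckPath n) HasseEdge HasseEdge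
      (delPeak n) :=
  isMonotoneGraphEpi_of_fibre_connected (isRelEpi_hasseEdge_delPeak n)
    (graphConnected_fibre_delPeak n)

instance (n : ℕ) : Finite (DyckPath n) :=
  inferInstanceAs (Finite {p : DyckWord // p.semilength = n})

/-- The limit starts at `D_1`, a single vertex; `InverseLimit.isKelley` uses this for connectedness
and as the default level. -/
instance : Subsingleton (DyckPath (0 + 1)) := ⟨fun P Q => by
  rw [← ofSeq_toSeq P, ← ofSeq_toSeq Q, ofSeq_eq_iff]
  intro j hj
  obtain rfl : j = 0 := by omega
  rw [AscentSeq.zero, AscentSeq.zero]⟩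

end DyckPath

/-! ### The inverse limit `D` -/

namespace AscentLimit

open DyckPath

/-- The vertex of the inverse limit with a given ascent sequence. -/
def ofSeq (x : AscentSeq) : AscentLimit :=
  ⟨fun n => DyckPath.ofSeq (n + 1) x, fun n => delPeak_ofSeq (n + 1) x⟩

theorem toSeq_coord {x : AscentLimit} {j n : ℕ} (h : j ≤ n) :
    (x.1 n).toSeq j = (x.1 j).toSeq j := by
  induction n, h using Nat.le_induction with
  | base => rfl
  | succ n hn ih =>
    rw [← ih, ← x.2 n, toSeq_delPeak, AscentSeq.trunc_apply_of_lt _ (by omega)]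

/-- The ascent sequence of a vertex of the inverse limit. -/
def toSeq (x : AscentLimit) : AscentSeq :=
  ⟨fun j => (x.1 j).toSeq j, fun i j h => by
    dsimp only
    rw [← toSeq_coord h]
    exact (x.1 j).toSeq.mono h, fun j => (x.1 j).toSeq.le_self j⟩

theorem toSeq_apply {x : AscentLimit} {j n : ℕ} (h : j ≤ n) : toSeq x j = (x.1 n).toSeq j :=
  (toSeq_coord h).symm

theorem toSeq_mono : Monotone toSeq := by
  intro x y h j
  obtain ⟨i, hi, hij⟩ := le_iff.1 (h j) j
  exact ⟨i, hi, by rw [toSeq_apply le_rfl, toSeq_apply hi, hij]⟩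

theorem ofSeq_mono : Monotone ofSeq := fun _ _ h n => DyckPath.ofSeq_mono (n + 1) h

theorem ofSeq_toSeq (x : AscentLimit) : ofSeq (toSeq x) = x := by
  refine Subtype.ext (funext fun n => Eq.trans ?_ (DyckPath.ofSeq_toSeq (x.1 n)))
  exact ofSeq_eq_iff.2 fun j hj => toSeq_apply (by omega)

theorem toSeq_ofSeq (x : AscentSeq) : toSeq (ofSeq x) = x := by
  refine AscentSeq.ext fun j => ?_
  change (DyckPath.ofSeq (j + 1) x).toSeq j = x j
  rw [DyckPath.toSeq_ofSeq, AscentSeq.trunc_apply_of_lt _ (by omega)]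

theorem isNonDistributiveLattice : IsNonDistributiveLattice AscentLimit := by
  obtain ⟨h₁, h₂, h₃⟩ := AscentSeq.pentagon
  exact isNonDistributiveLattice_of_retract toSeq_mono ofSeq_mono ofSeq_toSeq (toSeq_ofSeq _)
    (toSeq_ofSeq _) (toSeq_ofSeq _) h₁ h₂ h₃

theorem isKelley : IsKelley LimitEdge :=
  InverseLimit.isKelley (fun _ _ => Or.inl rfl) (fun _ => hasseEdge_symm)
    (fun _ P => ⟨ofSeq P.toSeq, DyckPath.ofSeq_toSeq P⟩)
    (fun _ => isMonotoneGraphEpi_delPeak _)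

end AscentLimit

theorem mainTheorem5 :
    (∀ n : ℕ, IsLatticeOrder (DyckPath n)) ∧
    (∀ n : ℕ, 3 ≤ n → IsNonDistributiveLattice (DyckPath n)) ∧
    (∀ n : ℕ, IsRelEpi (fun P Q : DyckPath (n + 1) => P ≤ Q) (fun P Q : DyckPath n => P ≤ Q)
      (DyckPath.delPeak n)) ∧
    (∀ n : ℕ, ∀ Q : DyckPath n,
      GraphConnected HasseEdge {P : DyckPath (n + 1) | DyckPath.delPeak n P = Q}) ∧
    (∀ n : ℕ, IsMonotoneGraphEpi (X := DyckPath (n + 1)) (Y := DyckPath n)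
      HasseEdge HasseEdge (DyckPath.delPeak n)) ∧
    IsKelley LimitEdge ∧
    IsNonDistributiveLattice AscentLimit :=
  ⟨DyckPath.isLatticeOrder, fun _ => DyckPath.isNonDistributiveLattice,
    DyckPath.isRelEpi_le_delPeak, DyckPath.graphConnected_fibre_delPeak,
    DyckPath.isMonotoneGraphEpi_delPeak, AscentLimit.isKelley,
    AscentLimit.isNonDistributiveLattice⟩
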